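/- Let $\mathbb K$ be a field, $X$ a set, $\langle X\rangle$ the free monoid of words on $X$ (with empty word $1$), and $\mathbb K\langle X\rangle$ the free algebra. Let $\prec$ be a monomial order on $\langle X\rangle$, i.e. a well-order compatible with left and right multiplication; $\mathrm{LM}(f)$ is the largest word in the support of a nonzero polynomial $f$, and $\mathrm{LM}(F)=\{\mathrm{LM}(f): f\in F,\ f\neq 0\}$. Let $A$ be a $\mathbb K$-algebra with an augmentation $\varepsilon:A\to\mathbb K$ (a homomorphism of unital $\mathbb K$-algebras), and let $\langle X\mid R\rangle$ be a presentation of $A$, i.e. $A\cong\mathbb K\langle X\rangle/I(R)$ with $I(R)$ the two-sided ideal generated by $R$; write $\overline g\in A$ for the image of $g\in\mathbb K\langle X\rangle$. Assume that $R$ is a minimal noncommutative Gröbner basis of $I(R)$: every word in $\mathrm{LM}(I(R))$ has a subword in $\mathrm{LM}(R)$, and no word in $\mathrm{LM}(R)$ is a subword of a different one. Let $V=\mathrm{LM}(R)$ (the obstructions), and assume that no single letter $x\in X$ belongs to $V$. A word is called normal if it is not in $\mathrm{LM}(I(R))$; every $a\in A$ has a unique normal form $\widehat a$, the linear combination of normal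 words with image $a$. Let $Q$ be the directed graph whose nodes are the empty word $1$, the letters $x\in X$ and the proper suffixes of obstructions, with an edge $1\to x$ for each $x\in X$ and an edge $s\to t$, for nodes $s,t\neq1$, whenever the word $st$ contains exactly one occurrence of an obstruction and this occurrence is a suffix of $st$. For $n\ge 0$ let $C_n$ (the $n$-chains) be the set of the products $w_0w_1\cdots w_n$ over all paths $1=w_0\to w_1\to\cdots\to w_n$ in $Q$. For $m\le n$, each $c\in C_n$ has a unique factorization $c=[c]^m[c]_m$ with $[c]^m\in C_m$ and $[c]_m\in\langle X\rangle$. Every $P\in\mathbb KC_n\otimes_{\mathbb K}A$ has a unique expression $P=\sum_{c\in C_n}c\otimes a_c$ with finitely many nonzero $a_c\in A$; if $P\neq0$, put $\mathrm{LM}(P)=\mathrm{LM}\bigl(\sum_c c\,\widehat{a_c}\bigr)$. Regard $\mathbb K$ as a right $A$-module through $\lambda\cdot a=\lambda\varepsilon(a)$. Then the right $A$-modules $\mathbb KC_n\otimes_{\mathbb K}A$ are free, and there are homomorphisms of right $A$-modules $d_n:\mathbb KC_n\otimes_{\mathbb K}A\to\mathbb KC_{n-1}\otimes_{\mathbb K}A$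 $(n\ge1)$ such that $$\cdots\to\mathbb KC_{n+1}\otimes_{\mathbb K}A\xrightarrow{d_{n+1}}\mathbb KC_n\otimes_{\mathbb K}A\to\cdots\xrightarrow{d_1}\mathbb KC_0\otimes_{\mathbb K}A\xrightarrow{\varepsilon}\mathbb K\to0$$ is exact, hence a free resolution of $\mathbb K$ by right $A$-modules (the last map being $1\otimes a\mapsto\varepsilon(a)$, as $C_0=\{1\}$), and such that for all $n\ge1$ and $c\in C_n$ $$d_n(c\otimes1_A)=[c]^{n-1}\otimes\overline{[c]_{n-1}}+\omega_c,$$ where either $\omega_c=0$ or $\mathrm{LM}(\omega_c)\prec c$. -/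

import Mathlib

open scoped TensorProduct

noncomputable section

namespace AnickResolution

universe u v w

/-! ### Monomial orders, leading monomials, noncommutative Gröbner bases -/

/-- A monomial order on the free monoid on `X`: a (strict) well-order that is compatible with
left and right multiplication. -/
structure WordOrder (X : Type u) where
  lt : FreeMonoid X → FreeMonoid X → Prop
  isWellOrder : IsWellOrder (FreeMonoid X) lt
  mul_lt_mul_left : ∀ a b c : FreeMonoid X, lt a b → lt (c * a) (c * b)
  mul_lt_mul_right : ∀ a b c : FreeMonoid X, lt a b → lt (a * c) (b * c)

section Words

variable {K : Type v} [Field K] {X : Type u}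

/-- `w` is the leading monomial of `f`: the largest monomial in the support of `f`.
This holds for no `w` if `f = 0`. -/
def IsLeadingMonomial (o : WordOrder X) (f : MonoidAlgebra K (FreeMonoid X))
    (w : FreeMonoid X) : Prop :=
  w ∈ f.coeff.support ∧ ∀ w' ∈ f.coeff.support, w' ≠ w → o.lt w' w

/-- The set of the leading monomials of the nonzero elements of `F`. -/
def leadingMonomials (o : WordOrder X) (F : Set (MonoidAlgebra K (FreeMonoid X))) :
    Set (FreeMonoid X) :=
  {w | ∃ f ∈ F, IsLeadingMonomial o f w}

/-- `v` is a subword (factor) of `w`. -/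
def IsSubword (v w : FreeMonoid X) : Prop := ∃ p q, p * v * q = w

/-- `G` is a noncommutative Gröbner basis of the two-sided ideal `I`. -/
def IsGroebnerBasis (o : WordOrder X) (I : TwoSidedIdeal (MonoidAlgebra K (FreeMonoid X)))
    (G : Set (MonoidAlgebra K (FreeMonoid X))) : Prop :=
  (∀ g ∈ G, g ∈ I) ∧
    ∀ w ∈ leadingMonomials o {f | f ∈ I}, ∃ v ∈ leadingMonomials o G, IsSubword v w

/-- A Gröbner basis is minimal if no leading monomial of it is divisible by another one. -/
def IsMinimalGroebnerBasis (o : WordOrder X)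
    (I : TwoSidedIdeal (MonoidAlgebra K (FreeMonoid X)))
    (G : Set (MonoidAlgebra K (FreeMonoid X))) : Prop :=
  IsGroebnerBasis o I G ∧
    ∀ v ∈ leadingMonomials o G, ∀ w ∈ leadingMonomials o G, IsSubword v w → v = w

/-- The set `O(I)` of normal words: the words that are not leading monomials of elements of `I`. -/
def normalWords (o : WordOrder X) (I : TwoSidedIdeal (MonoidAlgebra K (FreeMonoid X))) :
    Set (FreeMonoid X) :=
  (leadingMonomials o {f | f ∈ I})ᶜ

end Words

/-- A presentation of the algebra `A` by generators `X` and relations: a surjective algebra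
morphism from the free algebra onto `A` whose kernel is the two-sided ideal generated by the
relations. -/
structure Presentation (K : Type v) [Field K] (X : Type u) (A : Type w) [Ring A]
    [Algebra K A] where
  relations : Set (MonoidAlgebra K (FreeMonoid X))
  proj : MonoidAlgebra K (FreeMonoid X) →ₐ[K] A
  proj_surjective : Function.Surjective proj
  proj_eq_zero_iff : ∀ f, proj f = 0 ↔ f ∈ TwoSidedIdeal.span relations

namespace Presentation

variable {K : Type v} [Field K] {X : Type u} {A : Type w} [Ring A] [Algebra K A]

/-- The two-sided ideal `I(R)` generated by the relations. -/
def ideal (P : Presentation K X A) : TwoSidedIdeal (MonoidAlgebra K (FreeMonoid X)) :=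
  TwoSidedIdeal.span P.relations

/-- The image in `A` of a word. -/
def word (P : Presentation K X A) (w : FreeMonoid X) : A :=
  P.proj (MonoidAlgebra.single w 1)

end Presentation

/-! ### Normal forms -/

section NormalForm

variable {K : Type v} [Field K] {X : Type u} {A : Type w} [Ring A] [Algebra K A]

theorem exists_isLeadingMonomial (o : WordOrder X) (f : MonoidAlgebra K (FreeMonoid X))
    (hf : f ≠ 0) : ∃ w, IsLeadingMonomial o f w := by
  classical
  have := o.isWellOrder
  let _ : LinearOrder (FreeMonoid X) := linearOrderOfSTO o.lt
  have hne : f.coeff.support.Nonempty := by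
    rw [Finsupp.support_nonempty_iff]
    intro h
    exact hf (MonoidAlgebra.coeff_injective h)
  refine ⟨f.coeff.support.max' hne, Finset.max'_mem _ _, fun w' hw' hne' => ?_⟩
  exact lt_of_le_of_ne (Finset.le_max' _ _ hw') hne'

theorem exists_normalForm (o : WordOrder X) (P : Presentation K X A) (a : A) :
    ∃ f : MonoidAlgebra K (FreeMonoid X),
      P.proj f = a ∧ ∀ w ∈ f.coeff.support, w ∈ normalWords o P.ideal := by
  classical
  have := o.isWellOrder
  let N : Submodule K A :=
    Submodule.span K (P.word '' normalWords o P.ideal)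
  have key : ∀ w : FreeMonoid X, P.word w ∈ N := by
    intro w
    induction w using IsWellFounded.induction o.lt with
    | ind w ih =>
      by_cases hw : w ∈ normalWords o P.ideal
      · exact Submodule.subset_span ⟨w, hw, rfl⟩
      · simp only [normalWords, Set.mem_compl_iff, not_not] at hw
        obtain ⟨f, hfI, hwf, hlt⟩ := hw
        have hf0 : P.proj f = 0 := (P.proj_eq_zero_iff f).2 hfI
        have hsum : P.proj f = ∑ v ∈ f.coeff.support, f.coeff v • P.word v := by
          conv_lhs => rw [← MonoidAlgebra.sum_coeff_single f]
          rw [Finsupp.sum, map_sum]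
          refine Finset.sum_congr rfl fun v _ => ?_
          rw [Presentation.word, ← map_smul, MonoidAlgebra.smul_single, smul_eq_mul, mul_one]
        rw [hf0, ← Finset.add_sum_erase _ _ hwf] at hsum
        have hc : f.coeff w ≠ 0 := Finsupp.mem_support_iff.1 hwf
        have hmem : f.coeff w • P.word w ∈ N := by
          rw [eq_neg_of_add_eq_zero_left hsum.symm]
          refine N.neg_mem (N.sum_mem fun v hv => N.smul_mem _ (ih v ?_))
          exact hlt v (Finset.mem_of_mem_erase hv) (Finset.ne_of_mem_erase hv)
        exact (N.smul_mem_iff hc).1 hmem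
  have hall : a ∈ N := by
    obtain ⟨f, rfl⟩ := P.proj_surjective a
    rw [← MonoidAlgebra.sum_coeff_single f, Finsupp.sum, map_sum]
    refine N.sum_mem fun v _ => ?_
    have : P.proj (MonoidAlgebra.single v (f.coeff v)) = f.coeff v • P.word v := by
      rw [Presentation.word, ← map_smul, MonoidAlgebra.smul_single, smul_eq_mul, mul_one]
    rw [this]
    exact N.smul_mem _ (key v)
  induction hall using Submodule.span_induction with
  | mem x hx =>
    obtain ⟨w, hw, rfl⟩ := hx
    refine ⟨MonoidAlgebra.single w 1, rfl, fun v hv => ?_⟩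
    have : v ∈ ({w} : Finset (FreeMonoid X)) := Finsupp.support_single_subset hv
    rwa [Finset.mem_singleton.1 this]
  | zero => exact ⟨0, map_zero _, by simp⟩
  | add x y _ _ hx hy =>
    obtain ⟨f, rfl, hf⟩ := hx
    obtain ⟨g, rfl, hg⟩ := hy
    refine ⟨f + g, map_add _ _ _, fun v hv => ?_⟩
    rcases Finset.mem_union.1 (Finsupp.support_add hv) with h | h
    · exact hf v h
    · exact hg v h
  | smul c x _ hx =>
    obtain ⟨f, rfl, hf⟩ := hx
    exact ⟨c • f, map_smul _ _ _, fun v hv => hf v (Finsupp.support_smul hv)⟩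

theorem normalForm_unique (o : WordOrder X) (P : Presentation K X A)
    (f g : MonoidAlgebra K (FreeMonoid X)) (hfg : P.proj f = P.proj g)
    (hf : ∀ w ∈ f.coeff.support, w ∈ normalWords o P.ideal)
    (hg : ∀ w ∈ g.coeff.support, w ∈ normalWords o P.ideal) : f = g := by
  classical
  by_contra hne
  obtain ⟨w, hw⟩ := exists_isLeadingMonomial o (f - g) (sub_ne_zero.2 hne)
  have hI : f - g ∈ P.ideal := (P.proj_eq_zero_iff _).1 (by rw [map_sub, hfg, sub_self])
  have hnot : w ∉ normalWords o P.ideal := fun h => h ⟨f - g, hI, hw⟩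
  rcases Finset.mem_union.1 (Finsupp.support_sub hw.1) with h | h
  · exact hnot (hf w h)
  · exact hnot (hg w h)

/-- The normal form of an element `a` of `A`: the unique polynomial, all of whose monomials are
normal words, that represents `a`. -/
def normalForm (o : WordOrder X) (P : Presentation K X A) (a : A) :
    MonoidAlgebra K (FreeMonoid X) :=
  Classical.choose (exists_normalForm o P a)

end NormalForm

/-! ### Chains -/

section Chains

variable {X : Type u}

/-- The nodes of the graph of chains: the empty word, the letters and the proper suffixes of
obstructions. -/
def nodes (V : Set (FreeMonoid X)) : Set (FreeMonoid X) :=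
  {s | s = 1 ∨ (∃ x : X, s = FreeMonoid.of x) ∨ ∃ v ∈ V, ∃ p : FreeMonoid X, p ≠ 1 ∧ p * s = v}

/-- The word `w` contains exactly one occurrence of an obstruction, and this occurrence is a
suffix of `w`. -/
def HasUniqueObstructionAsSuffix (V : Set (FreeMonoid X)) (w : FreeMonoid X) : Prop :=
  ∃ p v : FreeMonoid X, v ∈ V ∧ p * v = w ∧
    ∀ p' v' q' : FreeMonoid X, v' ∈ V → p' * v' * q' = w → p' = p ∧ v' = v ∧ q' = 1

/-- The directed edges of the graph of chains. -/
def Edge (V : Set (FreeMonoid X)) (s t : FreeMonoid X) : Prop :=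
  (s = 1 ∧ ∃ x : X, t = FreeMonoid.of x) ∨
    (s ∈ nodes V ∧ s ≠ 1 ∧ t ∈ nodes V ∧ t ≠ 1 ∧ HasUniqueObstructionAsSuffix V (s * t))

/-- `PathFromOne V n s c`: there is a path of length `n` in the graph of chains that starts at
the node `1`, ends at the node `s`, and whose nodes have the product `c`. -/
inductive PathFromOne (V : Set (FreeMonoid X)) : ℕ → FreeMonoid X → FreeMonoid X → Prop
  | nil : PathFromOne V 0 1 1
  | cons {n : ℕ} {s t c : FreeMonoid X} (h : PathFromOne V n s c) (e : Edge V s t) :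
      PathFromOne V (n + 1) t (c * t)

/-- The set `C_n` of `n`-chains on `V`. -/
def chains (V : Set (FreeMonoid X)) (n : ℕ) : Set (FreeMonoid X) :=
  {c | ∃ s, PathFromOne V n s c}

theorem edge_unique (V : Set (FreeMonoid X)) {s t t' q q' : FreeMonoid X}
    (h : Edge V s t) (h' : Edge V s t') (hq : t * q = t' * q') : t = t' := by
  rcases h with ⟨hs, x, rfl⟩ | ⟨_, hs, _, _, p, v, hv, hpv, hu⟩
  · rcases h' with ⟨_, y, rfl⟩ | ⟨_, hs', _⟩
    · have := congrArg FreeMonoid.toList hq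
      simp only [FreeMonoid.toList_mul, FreeMonoid.toList_of, List.singleton_append,
        List.cons.injEq] at this
      rw [this.1]
    · exact absurd hs hs'
  · rcases h' with ⟨hs', _⟩ | ⟨_, _, _, _, p', v', hv', hpv', hu'⟩
    · exact absurd hs' hs
    · have hq2 : FreeMonoid.toList t ++ FreeMonoid.toList q
          = FreeMonoid.toList t' ++ FreeMonoid.toList q' := congrArg FreeMonoid.toList hq
      rcases List.append_eq_append_iff.1 hq2 with ⟨r, hr, _⟩ | ⟨r, hr, _⟩
      · have hr' : t' = t * FreeMonoid.ofList r := FreeMonoid.toList.injective hr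
        have h1 := (hu' p v (FreeMonoid.ofList r) hv (by rw [hpv, hr', mul_assoc])).2.2
        rw [hr', h1, mul_one]
      · have hr' : t = t' * FreeMonoid.ofList r := FreeMonoid.toList.injective hr
        have h1 := (hu p' v' (FreeMonoid.ofList r) hv' (by rw [hpv', hr', mul_assoc])).2.2
        rw [hr', h1, mul_one]

theorem path_unique (V : Set (FreeMonoid X)) {m : ℕ} {s c s' c' q q' : FreeMonoid X}
    (h : PathFromOne V m s c) (h' : PathFromOne V m s' c') (hq : c * q = c' * q') :
    s = s' ∧ c = c' := by
  induction m generalizing s c s' c' q q' with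
  | zero =>
    cases h
    cases h'
    exact ⟨rfl, rfl⟩
  | succ m ih =>
    cases h with
    | cons h e =>
      cases h' with
      | cons h' e' =>
        rw [mul_assoc, mul_assoc] at hq
        obtain ⟨rfl, rfl⟩ := ih h h' hq
        have := edge_unique V e e' (mul_left_cancel hq)
        subst this
        exact ⟨rfl, rfl⟩

theorem exists_prefix (V : Set (FreeMonoid X)) {n m : ℕ} (hm : m ≤ n) (c : chains V n) :
    ∃ p : chains V m × FreeMonoid X, (p.1 : FreeMonoid X) * p.2 = c := by
  obtain ⟨c, s, h⟩ := c
  induction h with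
  | nil =>
    obtain rfl : m = 0 := by omega
    exact ⟨(⟨1, 1, .nil⟩, 1), rfl⟩
  | @cons n s t c h e ih =>
    rcases Nat.lt_or_ge n m with hlt | hle
    · obtain rfl : m = n + 1 := by omega
      exact ⟨(⟨c * t, t, .cons h e⟩, 1), mul_one _⟩
    · obtain ⟨⟨c', u'⟩, hc⟩ := ih hle
      refine ⟨(c', u' * t), ?_⟩
      simp only at hc ⊢
      rw [← hc, mul_assoc]

theorem prefix_unique (V : Set (FreeMonoid X)) {n m : ℕ} (c : chains V n)
    (p p' : chains V m × FreeMonoid X) (hp : (p.1 : FreeMonoid X) * p.2 = c)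
    (hp' : (p'.1 : FreeMonoid X) * p'.2 = c) : p = p' := by
  obtain ⟨⟨c₁, s₁, h₁⟩, u₁⟩ := p
  obtain ⟨⟨c₂, s₂, h₂⟩, u₂⟩ := p'
  simp only at hp hp'
  have hq : c₁ * u₁ = c₂ * u₂ := hp.trans hp'.symm
  obtain ⟨_, rfl⟩ := path_unique V h₁ h₂ hq
  rw [mul_left_cancel hq]

/-- `[c]^m`: the unique `m`-chain that is a prefix of the `n`-chain `c`. -/
def upperBracket {V : Set (FreeMonoid X)} {n : ℕ} (c : chains V n) (m : ℕ) (hm : m ≤ n) :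
    chains V m :=
  (Classical.choose (exists_prefix V hm c)).1

/-- `[c]_m`: what is left of the `n`-chain `c` after removing the prefix `[c]^m`. -/
def lowerBracket {V : Set (FreeMonoid X)} {n : ℕ} (c : chains V n) (m : ℕ) (hm : m ≤ n) :
    FreeMonoid X :=
  (Classical.choose (exists_prefix V hm c)).2

end Chains

/-! ### The free right modules `KC_n ⊗ A` and the augmentation module `K`

Right `A`-modules are modules over the opposite ring of `A`. -/

section Modules

variable {K : Type v} [Field K] {X : Type u} {A : Type w} [Ring A] [Algebra K A]

/-- The tensor product over `K` of the vector space with basis the `n`-chains on `V` and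
of `A`. -/
def ChainModule (K : Type v) [Field K] {X : Type u} (A : Type w) [Ring A] [Algebra K A]
    (V : Set (FreeMonoid X)) (n : ℕ) : Type (max u v w) :=
  (chains V n →₀ K) ⊗[K] A

instance (V : Set (FreeMonoid X)) (n : ℕ) : AddCommGroup (ChainModule K A V n) :=
  inferInstanceAs (AddCommGroup ((chains V n →₀ K) ⊗[K] A))

/-- Right multiplication by `a` on the second factor: `z ⊗ b ↦ z ⊗ (b * a)`. -/
def rightMul (K : Type v) [Field K] {X : Type u} {A : Type w} [Ring A] [Algebra K A]
    (V : Set (FreeMonoid X)) (n : ℕ) (a : A) :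
    (chains V n →₀ K) ⊗[K] A →ₗ[K] (chains V n →₀ K) ⊗[K] A :=
  LinearMap.lTensor (chains V n →₀ K) (LinearMap.mulRight K a)

/-- The right `A`-module structure, `(z ⊗ b) · a = z ⊗ (b * a)`. -/
instance (V : Set (FreeMonoid X)) (n : ℕ) : Module Aᵐᵒᵖ (ChainModule K A V n) where
  smul a z := rightMul K V n a.unop z
  one_smul z := by
    have h : rightMul K V n (1 : A) = LinearMap.id := by
      rw [rightMul, LinearMap.mulRight_one, LinearMap.lTensor_id]
    exact DFunLike.congr_fun h z
  mul_smul a b z := by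
    have h : rightMul K V n (b.unop * a.unop) =
        rightMul K V n a.unop ∘ₗ rightMul K V n b.unop := by
      rw [rightMul, LinearMap.mulRight_mul, LinearMap.lTensor_comp]
      rfl
    exact DFunLike.congr_fun h z
  smul_zero a := map_zero (rightMul K V n a.unop)
  smul_add a := map_add (rightMul K V n a.unop)
  add_smul a b z := by
    have h : rightMul K V n (a.unop + b.unop) =
        rightMul K V n a.unop + rightMul K V n b.unop := by
      have h' : LinearMap.mulRight K (a.unop + b.unop) =
          LinearMap.mulRight K a.unop + LinearMap.mulRight K b.unop := by
        ext x
        simp [mul_add]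
      rw [rightMul, h', LinearMap.lTensor_add]
      rfl
    exact DFunLike.congr_fun h z
  zero_smul z := by
    have h : rightMul K V n (0 : A) = 0 := by
      rw [rightMul, LinearMap.mulRight_zero_eq_zero, LinearMap.lTensor_zero]
    exact DFunLike.congr_fun h z

/-- The element `c ⊗ a`. -/
def chainTmul {V : Set (FreeMonoid X)} {n : ℕ} (c : chains V n) (a : A) :
    ChainModule K A V n :=
  (Finsupp.single c (1 : K)) ⊗ₜ[K] a

/-- The polynomial attached to an element of the tensor product: it is obtained from
`c ⊗ a ↦ c * normalForm a`, where the given element is first written (uniquely) in the form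
`∑ c ⊗ a_c`, with `c` running through the `n`-chains. -/
def toPolynomial (o : WordOrder X) (P : Presentation K X A) {V : Set (FreeMonoid X)} {n : ℕ}
    (z : ChainModule K A V n) : MonoidAlgebra K (FreeMonoid X) :=
  letI := Classical.decEq (chains V n)
  (TensorProduct.finsuppScalarLeft K A (chains V n) z).sum fun c a =>
    MonoidAlgebra.single (c : FreeMonoid X) 1 * normalForm o P a

/-- The word `w` is the leading monomial of the element `z` of `KC_n ⊗ A`. -/
def IsHighTerm (o : WordOrder X) (P : Presentation K X A) {V : Set (FreeMonoid X)} {n : ℕ}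
    (z : ChainModule K A V n) (w : FreeMonoid X) : Prop :=
  IsLeadingMonomial o (toPolynomial o P z) w

/-- The field `K`, seen as a right `A`-module through the augmentation `ε`. -/
def AugmentationModule (_ε : A →ₐ[K] K) : Type v := K

instance (ε : A →ₐ[K] K) : AddCommGroup (AugmentationModule ε) :=
  inferInstanceAs (AddCommGroup K)

/-- The right action `l · a = l * ε a`. -/
instance (ε : A →ₐ[K] K) : Module Aᵐᵒᵖ (AugmentationModule ε) where
  smul := fun a (l : K) => (l * ε a.unop : K)
  one_smul := fun (l : K) => show l * ε 1 = l by rw [map_one, mul_one]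
  mul_smul := fun a b (l : K) =>
    show l * ε (b.unop * a.unop) = (l * ε b.unop) * ε a.unop by rw [map_mul, mul_assoc]
  smul_zero := fun a => zero_mul (ε a.unop)
  smul_add := fun a (l : K) (m : K) => add_mul l m (ε a.unop)
  add_smul := fun a b (l : K) =>
    show l * ε (a.unop + b.unop) = l * ε a.unop + l * ε b.unop by rw [map_add, mul_add]
  zero_smul := fun (l : K) => show l * ε 0 = 0 by rw [map_zero, mul_zero]

/-- The `K`-linear map from `KC_0 ⊗ A` to `K` that sends `c ⊗ a` to `ε a`. -/
def augmentationAux (ε : A →ₐ[K] K) (V : Set (FreeMonoid X)) :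
    (chains V 0 →₀ K) ⊗[K] A →ₗ[K] K :=
  TensorProduct.lift ((LinearMap.mul K K).compl₁₂
    (Finsupp.linearCombination K fun _ : chains V 0 => (1 : K)) ε.toLinearMap)

theorem augmentationAux_rightMul (ε : A →ₐ[K] K) (V : Set (FreeMonoid X)) (a : A)
    (z : (chains V 0 →₀ K) ⊗[K] A) :
    augmentationAux ε V (rightMul K V 0 a z) = augmentationAux ε V z * ε a := by
  induction z using TensorProduct.induction_on with
  | zero => simp only [map_zero, zero_mul]
  | tmul y b => simp [augmentationAux, rightMul, mul_assoc]
  | add y z hy hz => rw [map_add, map_add, hy, hz, map_add, add_mul]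

/-- The augmentation `KC_0 ⊗ A → K`, `1 ⊗ a ↦ ε a`, as a map of right `A`-modules. -/
def augmentation (ε : A →ₐ[K] K) (V : Set (FreeMonoid X)) :
    ChainModule K A V 0 →ₗ[Aᵐᵒᵖ] AugmentationModule ε where
  toFun z := augmentationAux ε V z
  map_add' y z := map_add (augmentationAux ε V) y z
  map_smul' a z := augmentationAux_rightMul ε V a.unop z

end Modules

end AnickResolution

end

open AnickResolution

/-! The elements c ⊗ w, with c an n-chain and w a normal word, form a K-basis of KC_n ⊗ A. The words
cw are pairwise distinct, because a word has at most one n-chain as a prefix (`chains_mul_inj`). So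
every nonzero element has one leading term, and the argument is a reduction of leading terms along
the well-order.

The differentials are built one at a time. The invariant `IsExtendable` of a map f out of KC_n ⊗ A
has two halves: the value of f at each [c]^n ⊗ [c]_n is also taken at some u below c, and every
leading term of a kernel element is a multiple of some [c]^n ⊗ [c]_n. The first half allows d(c ⊗ 1)
= [c]^n ⊗ [c]_n - u, so that f ∘ d = 0. The second half allows the leading term of a kernel element
to be removed by an element of the image of d; well-founded induction gives exactness, together with
a bound on the monomials of the preimages (`exists_mem_spanBelow_apply_eq`).

The invariant passes from f to d (`isExtendable_of_hasLeadingForm`). Let s be the last node of the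
chain c. Modulo smaller terms, d(c ⊗ w) is [c]^n ⊗ sw. If sw is normal, this term survives, so c ⊗ w
does not lead a kernel element. If sw is not normal, the shortest prefix t of w for which st
contains an obstruction gives an edge s → t (`exists_edge_prefix`), and ct is a chain. The induction
starts at the augmentation. -/

namespace AnickResolution

universe u v w

/-! ### Words and monomial orders -/

section Words

variable {X : Type u}

namespace WordOrder

variable (o : WordOrder X)

theorem lt_trans {a b c : FreeMonoid X} (hab : o.lt a b) (hbc : o.lt b c) : o.lt a c :=
  have := o.isWellOrder
  _root_.trans hab hbc

theorem lt_irrefl (a : FreeMonoid X) : ¬ o.lt a a :=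
  have := o.isWellOrder
  irrefl a

theorem lt_trichotomy (a b : FreeMonoid X) : o.lt a b ∨ a = b ∨ o.lt b a :=
  have := o.isWellOrder
  trichotomous_of o.lt a b

theorem wf : WellFounded o.lt :=
  have := o.isWellOrder
  IsWellFounded.wf

/-- If w were smaller than 1, its powers would form an infinite descending sequence. -/
theorem one_lt {w : FreeMonoid X} (hw : w ≠ 1) : o.lt 1 w := by
  rcases o.lt_trichotomy 1 w with h | h | h
  · exact h
  · exact absurd h.symm hw
  · have key : ∀ v : FreeMonoid X, ∀ k : ℕ, w ^ k ≠ v := fun v => by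
      induction v using o.wf.induction with
      | _ v ih =>
        rintro k rfl
        refine ih (w ^ (k + 1)) ?_ (k + 1) rfl
        simpa [pow_succ] using o.mul_lt_mul_left w 1 (w ^ k) h
    exact absurd rfl (key (w ^ 0) 0)

end WordOrder

theorem IsSubword.trans {a b c : FreeMonoid X} (hab : IsSubword a b) (hbc : IsSubword b c) :
    IsSubword a c := by
  obtain ⟨p, q, rfl⟩ := hab
  obtain ⟨p', q', rfl⟩ := hbc
  exact ⟨p' * p, q * q', by simp only [mul_assoc]⟩

theorem isSubword_mul_left (a b : FreeMonoid X) : IsSubword b (a * b) := ⟨a, 1, mul_one _⟩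

theorem isSubword_mul_right (a b : FreeMonoid X) : IsSubword a (a * b) := ⟨1, b, by rw [one_mul]⟩

theorem IsSubword.length_le {a b : FreeMonoid X} (h : IsSubword a b) : a.length ≤ b.length := by
  obtain ⟨p, q, rfl⟩ := h
  simp only [FreeMonoid.length_mul]
  omega

/-- Two factorizations of a word are comparable. -/
theorem mul_eq_mul_cases {a b c d : FreeMonoid X} (h : a * b = c * d) :
    (∃ r, c = a * r ∧ b = r * d) ∨ ∃ r, a = c * r ∧ d = r * b := by
  have h' : FreeMonoid.toList a ++ FreeMonoid.toList b
      = FreeMonoid.toList c ++ FreeMonoid.toList d := congrArg FreeMonoid.toList h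
  rcases List.append_eq_append_iff.1 h' with ⟨r, h1, h2⟩ | ⟨r, h1, h2⟩
  · exact .inl ⟨FreeMonoid.ofList r, FreeMonoid.toList.injective h1,
      FreeMonoid.toList.injective h2⟩
  · exact .inr ⟨FreeMonoid.ofList r, FreeMonoid.toList.injective h1,
      FreeMonoid.toList.injective h2⟩

theorem exists_of_mul {w : FreeMonoid X} (hw : w ≠ 1) : ∃ x u, w = FreeMonoid.of x * u := by
  induction w using FreeMonoid.casesOn with
  | one => exact absurd rfl hw
  | of_mul x u => exact ⟨x, u, rfl⟩

theorem exists_mul_of {w : FreeMonoid X} (hw : w ≠ 1) : ∃ u x, w = u * FreeMonoid.of x := by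
  rcases List.eq_nil_or_concat (FreeMonoid.toList w) with h | ⟨u, x, h⟩
  · exact absurd (FreeMonoid.toList.injective h) hw
  · exact ⟨FreeMonoid.ofList u, x, FreeMonoid.toList.injective (by simpa using h)⟩

end Words

/-! ### Normal words and the basis of A that they give -/

section NormalWords

variable {K : Type v} [Field K] {X : Type u} {A : Type w} [Ring A] [Algebra K A]
  {o : WordOrder X}

theorem IsLeadingMonomial.mul {f : MonoidAlgebra K (FreeMonoid X)} {v : FreeMonoid X}
    (h : IsLeadingMonomial o f v) (p q : FreeMonoid X) :
    IsLeadingMonomial o (MonoidAlgebra.single p 1 * f * MonoidAlgebra.single q 1) (p * v * q) := by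
  have hs : ∀ u, u ∈ (MonoidAlgebra.single p 1 * f * MonoidAlgebra.single q 1).coeff.support ↔
      ∃ u' ∈ f.coeff.support, p * u' * q = u := by
    intro u
    rw [MonoidAlgebra.support_coeff_mul_single _ _ (by simp),
      MonoidAlgebra.support_coeff_single_mul _ _ (by simp)]
    simp only [Finset.mem_map, mulRightEmbedding_apply, mulLeftEmbedding_apply,
      exists_exists_and_eq_and]
  refine ⟨(hs _).2 ⟨v, h.1, rfl⟩, fun u hu hne => ?_⟩
  obtain ⟨u', hu', rfl⟩ := (hs _).1 hu
  exact o.mul_lt_mul_right _ _ _ (o.mul_lt_mul_left _ _ _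
    (h.2 u' hu' fun e => hne (by rw [e])))

/-- Multiplying an element of I by words on both sides multiplies its leading monomial by them, so
non-normality passes to larger words. -/
theorem normalWords_of_isSubword {I : TwoSidedIdeal (MonoidAlgebra K (FreeMonoid X))}
    {v w : FreeMonoid X} (hw : w ∈ normalWords o I) (h : IsSubword v w) :
    v ∈ normalWords o I := by
  obtain ⟨p, q, rfl⟩ := h
  rintro ⟨f, hf, hv⟩
  exact hw ⟨_, I.mul_mem_right _ _ (I.mul_mem_left _ _ hf), hv.mul p q⟩

namespace IsMinimalGroebnerBasis

variable {I : TwoSidedIdeal (MonoidAlgebra K (FreeMonoid X))}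
  {G : Set (MonoidAlgebra K (FreeMonoid X))}

theorem notMem_normalWords (h : IsMinimalGroebnerBasis o I G) {v : FreeMonoid X}
    (hv : v ∈ leadingMonomials o G) : v ∉ normalWords o I := by
  obtain ⟨f, hf, hv⟩ := hv
  exact fun hn => hn ⟨f, h.1.1 f hf, hv⟩

theorem notMem_normalWords_iff (h : IsMinimalGroebnerBasis o I G) {w : FreeMonoid X} :
    w ∉ normalWords o I ↔ ∃ v ∈ leadingMonomials o G, IsSubword v w := by
  refine ⟨fun hw => h.1.2 w (not_not.1 hw), ?_⟩
  rintro ⟨v, hv, hvw⟩ hw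
  exact h.notMem_normalWords hv (normalWords_of_isSubword hw hvw)

end IsMinimalGroebnerBasis

namespace Presentation

variable (P : Presentation K X A)

theorem word_one : P.word 1 = 1 := map_one P.proj

theorem word_mul (v w : FreeMonoid X) : P.word (v * w) = P.word v * P.word w := by
  simp only [word]
  rw [← map_mul, MonoidAlgebra.single_mul_single, mul_one]

theorem proj_eq_sum (f : MonoidAlgebra K (FreeMonoid X)) :
    P.proj f = f.coeff.sum fun v a => a • P.word v := by
  conv_lhs => rw [← MonoidAlgebra.sum_coeff_single f]
  rw [Finsupp.sum, map_sum]
  refine Finset.sum_congr rfl fun v _ => ?_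
  simp only [word]
  rw [← map_smul, MonoidAlgebra.smul_single, smul_eq_mul, mul_one]

/-- As 1 is the least word, a relation with leading monomial 1 is a nonzero scalar, which would
vanish in A. -/
theorem one_mem_normalWords [Nontrivial A] (o : WordOrder X) : 1 ∈ normalWords o P.ideal := by
  rintro ⟨f, hf, h1, hlt⟩
  have hs : f.coeff.support = {1} := by
    refine Finset.eq_singleton_iff_unique_mem.2 ⟨h1, fun w hw => ?_⟩
    by_contra hne
    exact o.lt_irrefl _ (o.lt_trans (hlt w hw hne) (o.one_lt hne))
  have h0 := (P.proj_eq_zero_iff f).2 hf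
  rw [proj_eq_sum, Finsupp.sum, hs, Finset.sum_singleton, word_one, smul_eq_zero] at h0
  exact h0.elim (Finsupp.mem_support_iff.1 h1) one_ne_zero

/-- The image of a word that is not normal is a combination of smaller normal words. -/
theorem word_mem_span_lt (o : WordOrder X) {w : FreeMonoid X} (hw : w ∉ normalWords o P.ideal) :
    P.word w ∈ Submodule.span K (P.word '' {u | u ∈ normalWords o P.ideal ∧ o.lt u w}) := by
  classical
  induction w using o.wf.induction with
  | _ w ih =>
    obtain ⟨f, hfI, hwf, hlt⟩ := not_not.1 hw
    have hsum := (P.proj_eq_zero_iff f).2 hfI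
    rw [proj_eq_sum, Finsupp.sum, ← Finset.add_sum_erase _ _ hwf] at hsum
    have hc : f.coeff w ≠ 0 := Finsupp.mem_support_iff.1 hwf
    refine (Submodule.smul_mem_iff _ hc).1 ?_
    rw [eq_neg_of_add_eq_zero_left hsum]
    refine Submodule.neg_mem _ (Submodule.sum_mem _ fun v hv => Submodule.smul_mem _ _ ?_)
    have hvw := hlt v (Finset.mem_of_mem_erase hv) (Finset.ne_of_mem_erase hv)
    by_cases hn : v ∈ normalWords o P.ideal
    · exact Submodule.subset_span ⟨v, ⟨hn, hvw⟩, rfl⟩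
    · refine Submodule.span_mono (Set.image_mono fun u hu => ?_) (ih v hvw hn)
      exact ⟨hu.1, o.lt_trans hu.2 hvw⟩

theorem normalForm_eq_of_proj_eq {a : A} {f : MonoidAlgebra K (FreeMonoid X)}
    (h : P.proj f = a) (hf : ∀ w ∈ f.coeff.support, w ∈ normalWords o P.ideal) :
    normalForm o P a = f :=
  have hs := Classical.choose_spec (exists_normalForm o P a)
  normalForm_unique o P _ _ (hs.1.trans h.symm) hs.2 hf

variable (o) in
/-- The normal form as a linear map. -/
noncomputable def normalFormLinearMap : A →ₗ[K] MonoidAlgebra K (FreeMonoid X) where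
  toFun := normalForm o P
  map_add' a b := by
    classical
    have ha := Classical.choose_spec (exists_normalForm o P a)
    have hb := Classical.choose_spec (exists_normalForm o P b)
    refine P.normalForm_eq_of_proj_eq ?_ fun v hv => ?_
    · rw [map_add]
      exact congrArg₂ _ ha.1 hb.1
    · rcases Finset.mem_union.1 (Finsupp.support_add hv) with h | h
      · exact ha.2 v h
      · exact hb.2 v h
  map_smul' c a := by
    have ha := Classical.choose_spec (exists_normalForm o P a)
    refine P.normalForm_eq_of_proj_eq ?_ fun v hv => ha.2 v (Finsupp.support_smul hv)
    rw [RingHom.id_apply, map_smul]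
    exact congrArg _ ha.1

theorem normalForm_word {w : FreeMonoid X} (hw : w ∈ normalWords o P.ideal) :
    normalForm o P (P.word w) = MonoidAlgebra.single w 1 := by
  refine P.normalForm_eq_of_proj_eq rfl fun v hv => ?_
  have : v ∈ ({w} : Finset (FreeMonoid X)) := Finsupp.support_single_subset hv
  rwa [Finset.mem_singleton.1 this]

variable (o) in
/-- The basis of the algebra that consists of the images of the normal words. -/
noncomputable def normalBasis : Module.Basis (normalWords o P.ideal) K A :=
  Module.Basis.mk (v := fun w => P.word w)
    (by
      refine LinearIndependent.of_comp (P.normalFormLinearMap o) ?_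
      have : (P.normalFormLinearMap o ∘ fun w : normalWords o P.ideal => P.word w) =
          fun w : normalWords o P.ideal => MonoidAlgebra.single (w : FreeMonoid X) (1 : K) :=
        funext fun w => P.normalForm_word w.2
      rw [this]
      refine LinearIndependent.of_comp (MonoidAlgebra.coeffLinearEquiv K).toLinearMap ?_
      exact (Finsupp.linearIndependent_single_one K _).comp _ Subtype.val_injective)
    (by
      intro a _
      obtain ⟨f, rfl⟩ := P.proj_surjective a
      rw [proj_eq_sum]
      refine Submodule.sum_mem _ fun v _ => Submodule.smul_mem _ _ ?_
      by_cases hv : v ∈ normalWords o P.ideal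
      · exact Submodule.subset_span ⟨⟨v, hv⟩, rfl⟩
      · refine Submodule.span_mono ?_ (P.word_mem_span_lt o hv)
        rintro _ ⟨u, hu, rfl⟩
        exact ⟨⟨u, hu.1⟩, rfl⟩)

@[simp]
theorem normalBasis_apply (w : normalWords o P.ideal) : P.normalBasis o w = P.word w :=
  Module.Basis.mk_apply _ _ w

end Presentation

end NormalWords

/-! ### Combinatorics of chains -/

section Chains

variable {X : Type u} {V : Set (FreeMonoid X)}

theorem isSubword_of_iff {v : FreeMonoid X} {x : X} (h : IsSubword v (FreeMonoid.of x)) :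
    v = 1 ∨ v = FreeMonoid.of x := by
  obtain ⟨p, q, h⟩ := h
  have hl := congrArg FreeMonoid.length h
  simp only [FreeMonoid.length_mul, FreeMonoid.length_of] at hl
  rcases Nat.eq_zero_or_pos v.length with h0 | h0
  · exact .inl (FreeMonoid.length_eq_zero.1 h0)
  · have hp : p = 1 := FreeMonoid.length_eq_zero.1 (by omega)
    have hq : q = 1 := FreeMonoid.length_eq_zero.1 (by omega)
    subst hp hq
    exact .inr (by simpa using h)

theorem not_isSubword_of_mem_nodes (hmin : ∀ v ∈ V, ∀ w ∈ V, IsSubword v w → v = w)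
    (h1 : 1 ∉ V) (hletter : ∀ x : X, FreeMonoid.of x ∉ V) {s : FreeMonoid X}
    (hs : s ∈ nodes V) {v : FreeMonoid X} (hv : v ∈ V) : ¬ IsSubword v s := by
  intro hvs
  rcases hs with rfl | ⟨x, rfl⟩ | ⟨v', hv', p, hp, rfl⟩
  · have := hvs.length_le
    rw [FreeMonoid.length_one, Nat.le_zero, FreeMonoid.length_eq_zero] at this
    exact h1 (this ▸ hv)
  · rcases isSubword_of_iff hvs with h | h
    · exact h1 (h ▸ hv)
    · exact hletter x (h ▸ hv)
  · have h := hmin v hv _ hv' (hvs.trans (isSubword_mul_left p s))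
    have hl := hvs.length_le
    rw [h, FreeMonoid.length_mul] at hl
    exact hp (FreeMonoid.length_eq_zero.1 (by omega))

/-- Take for t the shortest prefix of w such that st contains an obstruction. By minimality every
obstruction in st ends where st ends, and two obstructions with the same end are comparable, hence
equal. -/
theorem exists_edge_prefix (hmin : ∀ v ∈ V, ∀ w ∈ V, IsSubword v w → v = w)
    (h1 : 1 ∉ V) (hletter : ∀ x : X, FreeMonoid.of x ∉ V) {s w : FreeMonoid X}
    (hs : s ∈ nodes V) (hs1 : s ≠ 1) (hw : ∀ v ∈ V, ¬ IsSubword v w)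
    (hsw : ∃ v ∈ V, IsSubword v (s * w)) : ∃ t w', w = t * w' ∧ Edge V s t := by
  classical
  have hex : ∃ k : ℕ, ∃ t w', t.length = k ∧ w = t * w' ∧ ∃ v ∈ V, IsSubword v (s * t) :=
    ⟨_, w, 1, rfl, (mul_one w).symm, hsw⟩
  obtain ⟨t, w', hk, rfl, v, hv, p, q, hpq⟩ := Nat.find_spec hex
  have hshort : ∀ t' y : FreeMonoid X, t = t' * y → y ≠ 1 →
      ∀ v ∈ V, ¬ IsSubword v (s * t') := by
    rintro t' y rfl hy v hv hvs
    have hle := Nat.find_min' hex ⟨t', y * w', rfl, by rw [mul_assoc], v, hv, hvs⟩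
    rw [← hk, FreeMonoid.length_mul] at hle
    exact hy (FreeMonoid.length_eq_zero.1 (by omega))
  have ht1 : t ≠ 1 := by
    rintro rfl
    exact not_isSubword_of_mem_nodes hmin h1 hletter hs hv ⟨p, q, by rw [hpq, mul_one]⟩
  have hsuffix : ∀ p v q : FreeMonoid X, v ∈ V → p * v * q = s * t → q = 1 := by
    intro p v q hv h
    by_contra hq
    obtain ⟨q', x, rfl⟩ := exists_mul_of hq
    obtain ⟨t', y, rfl⟩ := exists_mul_of ht1
    have hlast : p * v * q' = s * t' ∧ FreeMonoid.of x = FreeMonoid.of y := by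
      rw [← mul_assoc, ← mul_assoc] at h
      exact List.append_inj' (congrArg FreeMonoid.toList h) rfl
    exact hshort t' _ rfl (FreeMonoid.of_ne_one y) v hv ⟨p, q', hlast.1⟩
  obtain rfl := hsuffix p v q hv hpq
  rw [mul_one] at hpq
  refine ⟨t, w', rfl, .inr ⟨hs, hs1, .inr (.inr ?_), ht1, p, v, hv, hpq, ?_⟩⟩
  -- The obstruction must begin strictly inside s, since w contains none; this makes t a proper
  -- suffix of it, hence a node.
  · rcases mul_eq_mul_cases hpq with ⟨r, -, h⟩ | ⟨r, -, h⟩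
    · refine ⟨v, hv, r, ?_, h.symm⟩
      rintro rfl
      rw [one_mul] at h
      exact hw v hv (h ▸ isSubword_mul_right _ _)
    · exact absurd ⟨r, w', by rw [h]⟩ (hw v hv)
  · intro p' v' q' hv' h'
    obtain rfl := hsuffix p' v' q' hv' h'
    rw [mul_one] at h'
    have hvv : v' = v := by
      rcases mul_eq_mul_cases (h'.trans hpq.symm) with ⟨r, -, h⟩ | ⟨r, -, h⟩
      · exact (hmin v hv v' hv' (h ▸ isSubword_mul_left _ _)).symm
      · exact hmin v' hv' v hv (h ▸ isSubword_mul_left _ _)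
    subst hvv
    exact ⟨mul_right_cancel (h'.trans hpq.symm), rfl, rfl⟩

theorem PathFromOne.mem_nodes {n : ℕ} {s c : FreeMonoid X} (h : PathFromOne V (n + 1) s c) :
    s ∈ nodes V ∧ s ≠ 1 := by
  cases h with
  | cons _ e =>
    rcases e with ⟨-, x, rfl⟩ | ⟨-, -, ht, ht1, -⟩
    · exact ⟨.inr (.inl ⟨x, rfl⟩), FreeMonoid.of_ne_one x⟩
    · exact ⟨ht, ht1⟩

theorem upperBracket_mul_lowerBracket {n m : ℕ} (c : chains V n) (hm : m ≤ n) :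
    (upperBracket c m hm : FreeMonoid X) * lowerBracket c m hm = c :=
  Classical.choose_spec (exists_prefix V hm c)

theorem bracket_eq {n m : ℕ} {c : chains V n} (hm : m ≤ n) {c₀ : chains V m} {t : FreeMonoid X}
    (h : (c₀ : FreeMonoid X) * t = c) : upperBracket c m hm = c₀ ∧ lowerBracket c m hm = t :=
  Prod.ext_iff.1 (prefix_unique V c (Classical.choose (exists_prefix V hm c)) (c₀, t)
    (Classical.choose_spec (exists_prefix V hm c)) h)

theorem exists_edge_lowerBracket {n : ℕ} (c : chains V (n + 1)) :
    ∃ s, PathFromOne V n s (upperBracket c n n.le_succ) ∧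
      Edge V s (lowerBracket c n n.le_succ) ∧
      PathFromOne V (n + 1) (lowerBracket c n n.le_succ) c := by
  obtain ⟨c, t, h⟩ := c
  cases h with
  | @cons _ s _ c₀ h e =>
    obtain ⟨h1, h2⟩ := bracket_eq (c := ⟨c₀ * t, t, h.cons e⟩) n.le_succ
      (c₀ := ⟨c₀, s, h⟩) (t := t) rfl
    rw [h1, h2]
    exact ⟨s, h, e, h.cons e⟩

theorem exists_chain_of_edge {n : ℕ} {s t : FreeMonoid X} {c₀ : chains V n}
    (h : PathFromOne V n s c₀) (e : Edge V s t) :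
    ∃ c : chains V (n + 1), upperBracket c n n.le_succ = c₀ ∧
      lowerBracket c n n.le_succ = t :=
  ⟨⟨c₀ * t, t, h.cons e⟩, bracket_eq n.le_succ rfl⟩

theorem chains_mul_inj {n : ℕ} {c c' : chains V n} {q q' : FreeMonoid X}
    (h : (c : FreeMonoid X) * q = c' * q') : c = c' ∧ q = q' := by
  obtain ⟨c, s, hc⟩ := c
  obtain ⟨c', s', hc'⟩ := c'
  obtain ⟨-, rfl⟩ := path_unique V hc hc' h
  exact ⟨rfl, mul_left_cancel h⟩

end Chains

/-! ### The modules KC_n ⊗ A: freeness over A -/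

section Modules

variable {K : Type v} [Field K] {X : Type u} {A : Type w} [Ring A] [Algebra K A]
  {V : Set (FreeMonoid X)} {n : ℕ}

noncomputable instance : Module K (ChainModule K A V n) :=
  inferInstanceAs (Module K ((chains V n →₀ K) ⊗[K] A))

theorem op_smul_chainTmul (a : Aᵐᵒᵖ) (c : chains V n) (b : A) :
    a • (chainTmul c b : ChainModule K A V n) = chainTmul c (b * a.unop) := rfl

/-- Makes right A-linear maps K-linear, as needed to apply them to elements of the K-subspaces
`spanBelow`. -/
instance : IsScalarTower K Aᵐᵒᵖ (ChainModule K A V n) where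
  smul_assoc k a z := by
    have h : rightMul K V n (k • a.unop) = k • rightMul K V n a.unop := by
      have h' : LinearMap.mulRight K (k • a.unop) = k • LinearMap.mulRight K a.unop := by
        ext x
        simp
      rw [rightMul, h', LinearMap.lTensor_smul]
      rfl
    exact DFunLike.congr_fun h z

variable (K A V n) in
/-- The coordinates of an element of `KC_n ⊗ A` with respect to the elements `c ⊗ 1`. -/
noncomputable def chainCoords : ChainModule K A V n ≃ₗ[K] (chains V n →₀ Aᵐᵒᵖ) :=
  letI := Classical.decEq (chains V n)
  (TensorProduct.finsuppScalarLeft K A (chains V n)).trans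
    (Finsupp.mapRange.linearEquiv (MulOpposite.opLinearEquiv K))

theorem chainCoords_tmul (f : chains V n →₀ K) (b : A) (i : chains V n) :
    chainCoords K A V n (f ⊗ₜ[K] b : (chains V n →₀ K) ⊗[K] A) i = MulOpposite.op (f i • b) :=
  letI := Classical.decEq (chains V n)
  congrArg MulOpposite.op (TensorProduct.finsuppScalarLeft_apply_tmul_apply f b i)

theorem chainCoords_op_smul (a : Aᵐᵒᵖ) (z : ChainModule K A V n) :
    chainCoords K A V n (a • z) = a • chainCoords K A V n z := by
  refine TensorProduct.induction_on
    (motive := fun z : (chains V n →₀ K) ⊗[K] A =>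
      chainCoords K A V n (rightMul K V n a.unop z) = a • chainCoords K A V n z) z ?_ ?_ ?_
  · rw [map_zero]
    exact (map_zero (chainCoords K A V n)).trans
      ((congrArg _ (map_zero (chainCoords K A V n))).trans (smul_zero a)).symm
  · intro f b
    ext i
    rw [Finsupp.smul_apply, rightMul, LinearMap.lTensor_tmul, chainCoords_tmul, chainCoords_tmul]
    exact congrArg MulOpposite.op (smul_mul_assoc (f i) b a.unop).symm
  · intro y z hy hz
    rw [map_add]
    refine (map_add (chainCoords K A V n) _ _).trans ?_
    rw [hy, hz, ← smul_add]
    exact congrArg _ (map_add (chainCoords K A V n) y z).symm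

variable (K A V n) in
/-- The basis of the right module `KC_n ⊗ A` that consists of the elements `c ⊗ 1`. -/
noncomputable def chainFreeBasis : Module.Basis (chains V n) Aᵐᵒᵖ (ChainModule K A V n) :=
  Module.Basis.ofRepr
    { (chainCoords K A V n).toAddEquiv with map_smul' := chainCoords_op_smul }

@[simp]
theorem chainFreeBasis_apply (c : chains V n) :
    chainFreeBasis K A V n c = chainTmul c 1 := by
  classical
  refine (LinearEquiv.symm_apply_eq _).2 (Finsupp.ext fun i => ?_)
  refine Eq.trans ?_ (chainCoords_tmul (Finsupp.single c (1 : K)) (1 : A) i).symm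
  by_cases h : i = c
  · subst h
    simp
  · simp [Finsupp.single_eq_of_ne h]

/-! ### The K-basis c ⊗ w and the filtration by words -/

variable (o : WordOrder X) (P : Presentation K X A)

variable (V n) in
/-- The basis of the vector space `KC_n ⊗ A` that consists of the elements `c ⊗ w`,
where `w` is a normal word. -/
noncomputable def chainBasis :
    Module.Basis (chains V n × normalWords o P.ideal) K (ChainModule K A V n) :=
  Module.Basis.tensorProduct (Finsupp.basisSingleOne (ι := chains V n)) (P.normalBasis o)

theorem chainBasis_apply (i : chains V n × normalWords o P.ideal) :
    chainBasis V n o P i = chainTmul i.1 (P.word i.2) := by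
  obtain ⟨c, w⟩ := i
  refine (Module.Basis.tensorProduct_apply _ _ _ _).trans ?_
  rw [Finsupp.coe_basisSingleOne, Presentation.normalBasis_apply]
  rfl

/-- `c ⊗ a` as a linear function of `a`. -/
noncomputable def chainTmulLinearMap (c : chains V n) : A →ₗ[K] ChainModule K A V n :=
  TensorProduct.mk K (chains V n →₀ K) A (Finsupp.single c 1)

theorem chainTmulLinearMap_apply (c : chains V n) (a : A) :
    chainTmulLinearMap (K := K) c a = chainTmul c a := rfl

variable (V n) in
/-- The elements of `KC_n ⊗ A` all of whose monomials are smaller than the word `v`. -/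
noncomputable def spanBelow (v : FreeMonoid X) : Submodule K (ChainModule K A V n) :=
  Submodule.span K (chainBasis V n o P '' {i | o.lt (i.1 * i.2) v})

variable {o P}

theorem mem_spanBelow_iff {v : FreeMonoid X} {z : ChainModule K A V n} :
    z ∈ spanBelow V n o P v ↔
      ∀ i, (chainBasis V n o P).repr z i ≠ 0 → o.lt (i.1 * i.2) v := by
  rw [spanBelow, Module.Basis.mem_span_image]
  exact forall_congr' fun i => imp_congr_left (by rw [Finset.mem_coe, Finsupp.mem_support_iff])

theorem spanBelow_mono {v v' : FreeMonoid X} (h : o.lt v v') :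
    spanBelow V n o P v ≤ spanBelow V n o P v' :=
  Submodule.span_mono (Set.image_mono fun _ hi => o.lt_trans hi h)

/-- Rewriting a non-normal word into normal ones lowers it strictly, so the term drops below its own
word. This is what cancels the leading terms in d ∘ d. -/
theorem chainTmul_mem_spanBelow_of_notMem {c : chains V n} {w : FreeMonoid X}
    (hw : w ∉ normalWords o P.ideal) :
    (chainTmul c (P.word w) : ChainModule K A V n) ∈ spanBelow V n o P (c * w) := by
  have h := Submodule.mem_map_of_mem (f := chainTmulLinearMap (K := K) c) (P.word_mem_span_lt o hw)
  rw [Submodule.map_span, chainTmulLinearMap_apply] at h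
  refine Submodule.span_mono ?_ h
  rintro _ ⟨_, ⟨u, hu, rfl⟩, rfl⟩
  exact ⟨(c, ⟨u, hu.1⟩), o.mul_lt_mul_left _ _ _ hu.2, chainBasis_apply _ _ _⟩

theorem chainTmul_mem_spanBelow {c : chains V n} {w v : FreeMonoid X} (h : o.lt (c * w) v) :
    (chainTmul c (P.word w) : ChainModule K A V n) ∈ spanBelow V n o P v := by
  by_cases hw : w ∈ normalWords o P.ideal
  · exact Submodule.subset_span ⟨(c, ⟨w, hw⟩), h, chainBasis_apply _ _ _⟩
  · exact spanBelow_mono h (chainTmul_mem_spanBelow_of_notMem hw)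

theorem op_word_smul_mem_spanBelow {v : FreeMonoid X} {z : ChainModule K A V n}
    (hz : z ∈ spanBelow V n o P v) (w : FreeMonoid X) :
    MulOpposite.op (P.word w) • z ∈ spanBelow V n o P (v * w) := by
  induction hz using Submodule.span_induction with
  | mem z hz =>
    obtain ⟨⟨c, u⟩, hu, rfl⟩ := hz
    rw [chainBasis_apply, op_smul_chainTmul, MulOpposite.unop_op, ← P.word_mul]
    refine chainTmul_mem_spanBelow ?_
    rw [← mul_assoc]
    exact o.mul_lt_mul_right _ _ _ hu
  | zero => rw [smul_zero]; exact Submodule.zero_mem _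
  | add y z _ _ hy hz => rw [smul_add]; exact Submodule.add_mem _ hy hz
  | smul k z _ hz => rw [smul_comm]; exact Submodule.smul_mem _ _ hz

theorem chainTmul_notMem_spanBelow {c : chains V n} {w : FreeMonoid X}
    (hw : w ∈ normalWords o P.ideal) :
    (chainTmul c (P.word w) : ChainModule K A V n) ∉ spanBelow V n o P (c * w) := by
  have hb := chainBasis_apply o P (c, ⟨w, hw⟩)
  rw [← hb, mem_spanBelow_iff]
  intro h
  refine o.lt_irrefl _ (h (c, ⟨w, hw⟩) ?_)
  rw [Module.Basis.repr_self, Finsupp.single_eq_same]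
  exact one_ne_zero

/-- A nonzero element splits into its leading term and smaller terms. -/
theorem exists_leading_term {z : ChainModule K A V n} (hz : z ≠ 0) :
    ∃ (c : chains V n) (w : FreeMonoid X) (k : K), w ∈ normalWords o P.ideal ∧ k ≠ 0 ∧
      z - k • chainTmul c (P.word w) ∈ spanBelow V n o P (c * w) ∧
      ∀ v, z ∈ spanBelow V n o P v → o.lt (c * w) v := by
  classical
  set b := chainBasis V n o P
  have hne : (b.repr z).support.Nonempty := by
    rw [Finsupp.support_nonempty_iff]
    simpa using hz
  have := o.isWellOrder
  let _ : LinearOrder (FreeMonoid X) := linearOrderOfSTO o.lt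
  obtain ⟨⟨c, w⟩, hcw, hmax⟩ := Finset.exists_max_image (b.repr z).support
    (fun i => (i.1 * i.2 : FreeMonoid X)) hne
  have hk := Finsupp.mem_support_iff.1 hcw
  refine ⟨c, w, b.repr z (c, w), w.2, hk, ?_, fun v hv => mem_spanBelow_iff.1 hv _ hk⟩
  rw [mem_spanBelow_iff]
  intro i hi
  have hb := chainBasis_apply (V := V) (n := n) o P (c, w)
  rw [← hb, map_sub, map_smul, Module.Basis.repr_self, Finsupp.sub_apply, Finsupp.smul_apply] at hi
  have hic : i ≠ (c, w) := by
    rintro rfl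
    simp [b] at hi
  rw [Finsupp.single_eq_of_ne hic, smul_zero, sub_zero] at hi
  refine lt_of_le_of_ne (hmax i (Finsupp.mem_support_iff.2 hi)) fun h => hic ?_
  -- The maximum is attained only once, since distinct basis elements have distinct words.
  obtain ⟨h1, h2⟩ := chains_mul_inj h
  exact Prod.ext h1 (Subtype.ext h2)

/-! ### Comparison of the filtration with leading monomials -/

variable (o P) in
/-- `toPolynomial` as a linear map. -/
noncomputable def toPolynomialLinearMap :
    ChainModule K A V n →ₗ[K] MonoidAlgebra K (FreeMonoid X) :=
  letI := Classical.decEq (chains V n)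
  (Finsupp.lsum K fun c : chains V n =>
    LinearMap.mulLeft K (MonoidAlgebra.single (c : FreeMonoid X) (1 : K)) ∘ₗ
      P.normalFormLinearMap o) ∘ₗ (TensorProduct.finsuppScalarLeft K A (chains V n)).toLinearMap

theorem toPolynomialLinearMap_apply (z : ChainModule K A V n) :
    toPolynomialLinearMap o P z = toPolynomial o P z := rfl

theorem toPolynomial_chainBasis (i : chains V n × normalWords o P.ideal) :
    toPolynomial o P (chainBasis V n o P i) = MonoidAlgebra.single (i.1 * i.2 : FreeMonoid X) 1 := by
  let _ := Classical.decEq (chains V n)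
  have h : TensorProduct.finsuppScalarLeft K A (chains V n)
      (Finsupp.single i.1 (1 : K) ⊗ₜ[K] P.word i.2) = Finsupp.single i.1 (P.word i.2) := by
    rw [TensorProduct.finsuppScalarLeft_apply_tmul, Finsupp.sum_single_index] <;> simp
  rw [chainBasis_apply]
  refine (congrArg (fun f => f.sum fun c a =>
    MonoidAlgebra.single (c : FreeMonoid X) 1 * normalForm o P a) h).trans ?_
  rw [Finsupp.sum_single_index, P.normalForm_word i.2.2, MonoidAlgebra.single_mul_single, mul_one]
  exact (congrArg _ (map_zero (P.normalFormLinearMap o))).trans (mul_zero _)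

/-- Both sides are K-linear in z, so they need only agree on the basis c ⊗ w. As (c, w) ↦ cw is
injective, no coefficients merge. -/
theorem toPolynomial_eq (z : ChainModule K A V n) :
    (toPolynomial o P z).coeff =
      ((chainBasis V n o P).repr z).mapDomain fun i => (i.1 * i.2 : FreeMonoid X) := by
  have h : (MonoidAlgebra.coeffLinearEquiv K).toLinearMap ∘ₗ toPolynomialLinearMap o P =
      Finsupp.lmapDomain K K (fun i => (i.1 * i.2 : FreeMonoid X)) ∘ₗ
        (chainBasis V n o P).repr.toLinearMap := by
    refine (chainBasis V n o P).ext fun i => ?_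
    simp only [LinearMap.comp_apply, LinearEquiv.coe_coe, toPolynomialLinearMap_apply,
      toPolynomial_chainBasis, Module.Basis.repr_self, Finsupp.lmapDomain_apply,
      Finsupp.mapDomain_single]
    rfl
  exact DFunLike.congr_fun h z

theorem exists_isHighTerm_of_mem_spanBelow {v : FreeMonoid X} {z : ChainModule K A V n}
    (hz : z ∈ spanBelow V n o P v) : z = 0 ∨ ∃ w, IsHighTerm o P z w ∧ o.lt w v := by
  classical
  refine or_iff_not_imp_left.2 fun hz0 => ?_
  have hinj : Function.Injective
      fun i : chains V n × normalWords o P.ideal => (i.1 * i.2 : FreeMonoid X) := fun i j h =>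
    Prod.ext (chains_mul_inj h).1 (Subtype.ext (chains_mul_inj h).2)
  have hne : toPolynomial o P z ≠ 0 := by
    rw [← MonoidAlgebra.coeff_eq_zero.ne, toPolynomial_eq]
    intro h
    rw [← Finsupp.mapDomain_zero] at h
    have := Finsupp.mapDomain_injective hinj h
    exact hz0 (by simpa using this)
  obtain ⟨w, hw⟩ := exists_isLeadingMonomial o _ hne
  refine ⟨w, hw, ?_⟩
  have hmem := hw.1
  rw [toPolynomial_eq] at hmem
  obtain ⟨i, hi, rfl⟩ := Finset.mem_image.1 (Finsupp.mapDomain_support hmem)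
  exact mem_spanBelow_iff.1 hz i (Finsupp.mem_support_iff.1 hi)

end Modules

/-! ### Inductive construction of the differentials -/

section Resolution

variable {K : Type v} [Field K] {X : Type u} {A : Type w} [Ring A] [Algebra K A]
  {o : WordOrder X} {P : Presentation K X A} {V : Set (FreeMonoid X)} {n : ℕ}

/-- `V` is an antichain of words of length at least two, and the normal words are the words that
avoid `V`. -/
structure IsObstructionSet (o : WordOrder X) (P : Presentation K X A)
    (V : Set (FreeMonoid X)) : Prop where
  eq_of_isSubword : ∀ v ∈ V, ∀ w ∈ V, IsSubword v w → v = w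
  one_notMem : 1 ∉ V
  of_notMem : ∀ x : X, FreeMonoid.of x ∉ V
  notMem_normalWords_iff : ∀ w, w ∉ normalWords o P.ideal ↔ ∃ v ∈ V, IsSubword v w

theorem IsMinimalGroebnerBasis.isObstructionSet [Nontrivial A]
    (h : IsMinimalGroebnerBasis o P.ideal P.relations)
    (hletter : ∀ x : X, FreeMonoid.of x ∉ leadingMonomials o P.relations) :
    IsObstructionSet o P (leadingMonomials o P.relations) where
  eq_of_isSubword := h.2
  one_notMem h1 := h.notMem_normalWords h1 (P.one_mem_normalWords o)
  of_notMem := hletter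
  notMem_normalWords_iff _ := h.notMem_normalWords_iff

theorem IsObstructionSet.exists_edge_prefix (hV : IsObstructionSet o P V) {s w : FreeMonoid X}
    (hs : s ∈ nodes V) (hs1 : s ≠ 1) (hw : w ∈ normalWords o P.ideal)
    (hsw : s * w ∉ normalWords o P.ideal) : ∃ t w', w = t * w' ∧ Edge V s t := by
  refine AnickResolution.exists_edge_prefix hV.eq_of_isSubword hV.one_notMem hV.of_notMem hs hs1
    (fun v hv hvw => ?_) ((hV.notMem_normalWords_iff _).1 hsw)
  exact (hV.notMem_normalWords_iff w).2 ⟨v, hv, hvw⟩ hw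

/-- The differential `d` has the form `c ⊗ 1 ↦ [c]^n ⊗ [c]_n + (smaller terms)`. -/
def HasLeadingForm (o : WordOrder X) (P : Presentation K X A)
    (d : ChainModule K A V (n + 1) →ₗ[Aᵐᵒᵖ] ChainModule K A V n) : Prop :=
  ∀ c : chains V (n + 1), d (chainTmul c 1) -
    chainTmul (upperBracket c n n.le_succ) (P.word (lowerBracket c n n.le_succ)) ∈
      spanBelow V n o P c

namespace HasLeadingForm

variable {d : ChainModule K A V (n + 1) →ₗ[Aᵐᵒᵖ] ChainModule K A V n}

theorem sub_mem_spanBelow (hd : HasLeadingForm o P d) (c : chains V (n + 1)) (w : FreeMonoid X) :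
    d (chainTmul c (P.word w)) - chainTmul (upperBracket c n n.le_succ)
      (P.word (lowerBracket c n n.le_succ * w)) ∈ spanBelow V n o P (c * w) := by
  have h := op_word_smul_mem_spanBelow (hd c) w
  rwa [smul_sub, ← map_smul, op_smul_chainTmul, op_smul_chainTmul, MulOpposite.unop_op, one_mul,
    ← P.word_mul] at h

/-- The main term of d(c ⊗ w) has the same underlying word cw, because [c]^n [c]_n = c; hence d
raises no bound. -/
theorem apply_mem_spanBelow (hd : HasLeadingForm o P d) {v : FreeMonoid X}
    {z : ChainModule K A V (n + 1)} (hz : z ∈ spanBelow V (n + 1) o P v) :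
    d z ∈ spanBelow V n o P v := by
  induction hz using Submodule.span_induction with
  | mem z hz =>
    obtain ⟨⟨c, w⟩, hcw, rfl⟩ := hz
    rw [chainBasis_apply]
    have h := spanBelow_mono hcw (hd.sub_mem_spanBelow c w)
    rw [← Submodule.sub_mem_iff_left _ (chainTmul_mem_spanBelow ?_)]
    · exact h
    · rwa [← mul_assoc, upperBracket_mul_lowerBracket]
  | zero => rw [map_zero]; exact Submodule.zero_mem _
  | add y z _ _ hy hz => rw [map_add]; exact Submodule.add_mem _ hy hz
  | smul k z _ hz =>
    rw [← d.restrictScalars_apply K, map_smul]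
    exact Submodule.smul_mem _ _ hz

end HasLeadingForm

/-- The property of a map out of `KC_n ⊗ A` that allows to continue the resolution by one step:
the images of the elements `[c]^n ⊗ [c]_n` come from smaller elements, and the leading terms of
the elements of the kernel are multiples of the elements `[c]^n ⊗ [c]_n`. -/
structure IsExtendable (o : WordOrder X) (P : Presentation K X A) {N : Type*} [AddCommGroup N]
    [Module Aᵐᵒᵖ N] (f : ChainModule K A V n →ₗ[Aᵐᵒᵖ] N) : Prop where
  exists_apply_eq : ∀ c : chains V (n + 1), ∃ u ∈ spanBelow V n o P c,
    f (chainTmul (upperBracket c n n.le_succ) (P.word (lowerBracket c n n.le_succ))) = f u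
  exists_chain : ∀ (z : ChainModule K A V n) (c₀ : chains V n) (w : FreeMonoid X) (k : K),
    f z = 0 → w ∈ normalWords o P.ideal → k ≠ 0 →
    z - k • chainTmul c₀ (P.word w) ∈ spanBelow V n o P (c₀ * w) →
    ∃ (c : chains V (n + 1)) (w' : FreeMonoid X),
      upperBracket c n n.le_succ = c₀ ∧ w = lowerBracket c n n.le_succ * w'

namespace IsExtendable

variable {N : Type*} [AddCommGroup N] [Module Aᵐᵒᵖ N] {f : ChainModule K A V n →ₗ[Aᵐᵒᵖ] N}
  {d : ChainModule K A V (n + 1) →ₗ[Aᵐᵒᵖ] ChainModule K A V n}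

theorem exists_hasLeadingForm (hf : IsExtendable o P f) :
    ∃ d : ChainModule K A V (n + 1) →ₗ[Aᵐᵒᵖ] ChainModule K A V n,
      HasLeadingForm o P d ∧ ∀ z, f (d z) = 0 := by
  choose u hu hfu using hf.exists_apply_eq
  -- The auxiliary scalars of `constr` must commute with the action of the possibly noncommutative
  -- ring `Aᵐᵒᵖ`; ℕ always does.
  let d := (chainFreeBasis K A V (n + 1)).constr ℕ fun c =>
    chainTmul (upperBracket c n n.le_succ) (P.word (lowerBracket c n n.le_succ)) - u c
  have hd : ∀ c, d (chainTmul c 1) =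
      chainTmul (upperBracket c n n.le_succ) (P.word (lowerBracket c n n.le_succ)) - u c := by
    intro c
    rw [← chainFreeBasis_apply]
    exact Module.Basis.constr_basis _ _ _ _
  refine ⟨d, fun c => ?_, fun z => ?_⟩
  · rw [hd, sub_sub_cancel_left]
    exact Submodule.neg_mem _ (hu c)
  · have h : f ∘ₗ d = 0 := (chainFreeBasis K A V (n + 1)).ext fun c => by
      rw [chainFreeBasis_apply, LinearMap.comp_apply, hd, map_sub, hfu, sub_self,
        LinearMap.zero_apply]
    exact DFunLike.congr_fun h z

/-- The leading term of an element of the kernel can be removed with an element of the image. -/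
theorem exists_reduction (hf : IsExtendable o P f) (hd : HasLeadingForm o P d)
    {z : ChainModule K A V n} (hz : z ≠ 0) (hfz : f z = 0) :
    ∃ (u : FreeMonoid X) (y : ChainModule K A V (n + 1)), z - d y ∈ spanBelow V n o P u ∧
      ∀ v, z ∈ spanBelow V n o P v → o.lt u v ∧ y ∈ spanBelow V (n + 1) o P v := by
  obtain ⟨c₀, w, k, hw, hk, hlow, hlt⟩ := exists_leading_term (o := o) (P := P) hz
  obtain ⟨c, w', rfl, rfl⟩ := hf.exists_chain z c₀ w k hfz hw hk hlow
  have hc := upperBracket_mul_lowerBracket c n.le_succ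
  rw [← mul_assoc, hc] at hlow hlt
  -- The word cw' is the leading word of z itself, so any bound for z also bounds the correction.
  refine ⟨c * w', k • chainTmul c (P.word w'), ?_, fun v hv =>
    ⟨hlt v hv, Submodule.smul_mem _ _ (chainTmul_mem_spanBelow (hlt v hv))⟩⟩
  have h := Submodule.sub_mem _ hlow (Submodule.smul_mem _ k (hd.sub_mem_spanBelow c w'))
  rwa [smul_sub, sub_sub, add_sub_cancel, ← d.restrictScalars_apply K, ← map_smul] at h

/-- Repeated reduction of leading terms terminates by well-foundedness. Keeping the bound v for the
preimage is what controls the lower terms of the next differential. -/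
theorem exists_mem_spanBelow_apply_eq (hf : IsExtendable o P f) (hd : HasLeadingForm o P d)
    (hfd : ∀ z, f (d z) = 0) (v : FreeMonoid X) :
    ∀ z ∈ spanBelow V n o P v, f z = 0 → ∃ y ∈ spanBelow V (n + 1) o P v, d y = z := by
  induction v using o.wf.induction with
  | _ v ih =>
    intro z hz hfz
    by_cases h0 : z = 0
    · exact ⟨0, Submodule.zero_mem _, by rw [map_zero, h0]⟩
    · obtain ⟨u, y, hy, huv⟩ := hf.exists_reduction hd h0 hfz
      obtain ⟨huv, hyv⟩ := huv v hz
      obtain ⟨y', hy', h⟩ := ih u huv _ hy (by rw [map_sub, hfz, hfd, sub_zero])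
      exact ⟨y' + y, Submodule.add_mem _ (spanBelow_mono huv hy') hyv, by
        rw [map_add, h, sub_add_cancel]⟩

theorem exact (hf : IsExtendable o P f) (hd : HasLeadingForm o P d) (hfd : ∀ z, f (d z) = 0) :
    Function.Exact d f := by
  refine fun z => ⟨fun hfz => ?_, ?_⟩
  · by_cases h0 : z = 0
    · exact ⟨0, by rw [map_zero, h0]⟩
    -- One reduction supplies a bound u; z itself need not lie strictly below any word.
    · obtain ⟨u, y, hy, -⟩ := hf.exists_reduction hd h0 hfz
      obtain ⟨y', -, h⟩ := hf.exists_mem_spanBelow_apply_eq hd hfd u _ hy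
        (by rw [map_sub, hfz, hfd, sub_zero])
      exact ⟨y' + y, by rw [map_add, h, sub_add_cancel]⟩
  · rintro ⟨y, rfl⟩
    exact hfd y

theorem isExtendable_of_hasLeadingForm (hf : IsExtendable o P f) (hV : IsObstructionSet o P V)
    (hd : HasLeadingForm o P d) (hfd : ∀ z, f (d z) = 0) : IsExtendable o P d where
  exists_apply_eq c := by
    obtain ⟨s, hs, he, -⟩ := exists_edge_lowerBracket c
    have hcc := upperBracket_mul_lowerBracket c (n + 1).le_succ
    set c' := upperBracket c (n + 1) (n + 1).le_succ
    set t := lowerBracket c (n + 1) (n + 1).le_succ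
    obtain ⟨-, -, -, hs'⟩ := exists_edge_lowerBracket c'
    -- The last node of the path of c' is its tail [c']_n, so the edge to t starts there.
    obtain ⟨rfl, -⟩ := path_unique V (q := 1) (q' := 1) hs hs' rfl
    have hst : lowerBracket c' n n.le_succ * t ∉ normalWords o P.ideal := by
      rcases he with ⟨h1, -⟩ | ⟨-, -, -, -, p, v, hv, hpv, -⟩
      · exact absurd h1 hs.mem_nodes.2
      · exact (hV.notMem_normalWords_iff _).2 ⟨v, hv, hpv ▸ isSubword_mul_left p v⟩
    have h1 := hd.sub_mem_spanBelow c' t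
    have h2 := chainTmul_mem_spanBelow_of_notMem (c := upperBracket c' n n.le_succ) hst
    rw [← mul_assoc, upperBracket_mul_lowerBracket] at h2
    rw [Submodule.sub_mem_iff_left _ h2, hcc] at h1
    -- The main term of d(c' ⊗ t) is not normal, so this element of the kernel of f lies below c,
    -- and it lifts to some u below c.
    obtain ⟨u, hu, hdu⟩ := hf.exists_mem_spanBelow_apply_eq hd hfd _ _ h1 (hfd _)
    exact ⟨u, hu, hdu.symm⟩
  exists_chain z c w k hz hw hk hlow := by
    obtain ⟨-, -, -, hs⟩ := exists_edge_lowerBracket c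
    have hsw : lowerBracket c n n.le_succ * w ∉ normalWords o P.ideal := by
      intro hsw
      -- From d z = 0, the term d(c ⊗ w) would lie below cw, and so would its main term; but with a
      -- normal second factor that term is a basis element with word exactly cw.
      refine chainTmul_notMem_spanBelow (c := upperBracket c n n.le_succ) hsw ?_
      rw [← mul_assoc, upperBracket_mul_lowerBracket]
      have h1 := hd.apply_mem_spanBelow hlow
      rw [map_sub, hz, zero_sub, Submodule.neg_mem_iff, ← d.restrictScalars_apply K, map_smul,
        Submodule.smul_mem_iff _ hk, LinearMap.restrictScalars_apply] at h1
      exact (Submodule.sub_mem_iff_right _ h1).1 (hd.sub_mem_spanBelow c w)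
    obtain ⟨t, w', rfl, he⟩ := hV.exists_edge_prefix hs.mem_nodes.1 hs.mem_nodes.2 hw hsw
    obtain ⟨c', h1, h2⟩ := exists_chain_of_edge hs he
    exact ⟨c', w', h1, by rw [h2]⟩

theorem exists_exact (hf : IsExtendable o P f) (hV : IsObstructionSet o P V) :
    ∃ d : ChainModule K A V (n + 1) →ₗ[Aᵐᵒᵖ] ChainModule K A V n,
      HasLeadingForm o P d ∧ Function.Exact d f ∧ IsExtendable o P d := by
  obtain ⟨d, hd, hfd⟩ := hf.exists_hasLeadingForm
  exact ⟨d, hd, hf.exact hd hfd, hf.isExtendable_of_hasLeadingForm hV hd hfd⟩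

end IsExtendable

/-! ### The augmentation as start of the induction -/

section Augmentation

variable (ε : A →ₐ[K] K)

theorem augmentation_chainTmul (c : chains V 0) (a : A) :
    augmentation ε V (chainTmul c a) = (ε a : K) := by
  change augmentationAux ε V (Finsupp.single c (1 : K) ⊗ₜ[K] a) = ε a
  simp [augmentationAux]

theorem augmentation_smul_chainTmul (k : K) (c : chains V 0) (a : A) :
    augmentation ε V (k • chainTmul c a) = (k * ε a : K) := by
  change augmentationAux ε V (k • Finsupp.single c (1 : K) ⊗ₜ[K] a) = k * ε a
  simp [augmentationAux]

theorem coe_chain_zero (c : chains V 0) : (c : FreeMonoid X) = 1 := by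
  obtain ⟨c, s, h⟩ := c
  cases h
  rfl

theorem augmentation_surjective : Function.Surjective (augmentation ε V) := by
  intro k
  refine ⟨chainTmul ⟨1, 1, .nil⟩ (algebraMap K A k), ?_⟩
  rw [augmentation_chainTmul]
  exact ε.commutes k

theorem spanBelow_zero_one : spanBelow V 0 o P 1 = ⊥ := by
  refine Submodule.span_eq_bot.2 ?_
  rintro _ ⟨⟨c, w⟩, h, rfl⟩
  have h' : o.lt (c * w) 1 := h
  rw [coe_chain_zero, one_mul] at h'
  by_cases hw : (w : FreeMonoid X) = 1
  · exact absurd (hw ▸ h') (o.lt_irrefl _)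
  · exact absurd (o.lt_trans h' (o.one_lt hw)) (o.lt_irrefl _)

theorem isExtendable_augmentation : IsExtendable o P (augmentation ε V) where
  exists_apply_eq c := by
    have hc0 := coe_chain_zero (upperBracket c 0 (Nat.le_succ 0))
    have hc := upperBracket_mul_lowerBracket c (Nat.le_succ 0)
    have hc1 : (c : FreeMonoid X) ≠ 1 := by
      obtain ⟨-, -, -, hs⟩ := exists_edge_lowerBracket c
      rw [← hc, hc0, one_mul]
      exact hs.mem_nodes.2
    -- For a letter x, the elements 1 ⊗ x and ε(x)(1 ⊗ 1) have the same augmentation, and 1 is below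
    -- x.
    refine ⟨(ε (P.word (lowerBracket c 0 (Nat.le_succ 0)))) •
      chainTmul (upperBracket c 0 (Nat.le_succ 0)) (P.word 1),
      Submodule.smul_mem _ _ (chainTmul_mem_spanBelow ?_), ?_⟩
    · rw [hc0, mul_one]
      exact o.one_lt hc1
    · rw [augmentation_smul_chainTmul, augmentation_chainTmul, P.word_one, map_one, mul_one]
  exists_chain z c₀ w k hz hw hk hlow := by
    -- Nothing lies below 1, so with leading word 1 the element would be k(1 ⊗ 1), whose
    -- augmentation is k ≠ 0.
    have hw1 : w ≠ 1 := by
      rintro rfl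
      rw [mul_one, coe_chain_zero, spanBelow_zero_one, Submodule.mem_bot, sub_eq_zero] at hlow
      rw [hlow, augmentation_smul_chainTmul, P.word_one, map_one, mul_one] at hz
      exact hk hz
    obtain ⟨x, w', rfl⟩ := exists_of_mul hw1
    have h : PathFromOne V 0 1 (c₀ : FreeMonoid X) := by
      rw [coe_chain_zero]
      exact .nil
    obtain ⟨c, h1, h2⟩ := exists_chain_of_edge h (.inl ⟨rfl, x, rfl⟩)
    exact ⟨c, w', h1, by rw [h2]⟩

end Augmentation

end Resolution

end AnickResolution

/-! ### The resolution -/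

theorem mainTheorem1 {K : Type*} [Field K] {X : Type*} {A : Type*} [Ring A] [Algebra K A]
    (ε : A →ₐ[K] K) (o : WordOrder X) (P : Presentation K X A)
    (hR : IsMinimalGroebnerBasis o P.ideal P.relations)
    (V : Set (FreeMonoid X)) (hV : V = leadingMonomials o P.relations)
    (hletter : ∀ x : X, FreeMonoid.of x ∉ V) :
    (∀ n : ℕ, Module.Free Aᵐᵒᵖ (ChainModule K A V n)) ∧
    ∃ d : ∀ n : ℕ, ChainModule K A V (n + 1) →ₗ[Aᵐᵒᵖ] ChainModule K A V n,
      (∀ (n : ℕ) (c : chains V (n + 1)), ∃ ω : ChainModule K A V n,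
        d n (chainTmul c 1) =
            chainTmul (upperBracket c n n.le_succ) (P.word (lowerBracket c n n.le_succ)) + ω ∧
          (ω = 0 ∨ ∃ w : FreeMonoid X, IsHighTerm o P ω w ∧ o.lt w c)) ∧
      (∀ n : ℕ, Function.Exact (d (n + 1)) (d n)) ∧
      Function.Exact (d 0) (augmentation ε V) ∧
      Function.Surjective (augmentation ε V) := by
  have : Nontrivial A := ε.toRingHom.domain_nontrivial
  have hObs : IsObstructionSet o P V := by
    subst hV
    exact hR.isObstructionSet hletter
  refine ⟨fun n => .of_basis (chainFreeBasis K A V n), ?_⟩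
  obtain ⟨d₀, hd₀, hex₀, hext₀⟩ := (isExtendable_augmentation (o := o) (P := P) ε).exists_exact hObs
  -- The recursion carries only what the next choice needs; exactness of consecutive maps is read
  -- off from the choice itself.
  let D : ∀ n : ℕ, {d : ChainModule K A V (n + 1) →ₗ[Aᵐᵒᵖ] ChainModule K A V n //
      HasLeadingForm o P d ∧ IsExtendable o P d} := fun n =>
    Nat.rec ⟨d₀, hd₀, hext₀⟩ (fun _ d => ⟨(d.2.2.exists_exact hObs).choose,
      (d.2.2.exists_exact hObs).choose_spec.1, (d.2.2.exists_exact hObs).choose_spec.2.2⟩) n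
  refine ⟨fun n => (D n).1, fun n c => ⟨_, (add_sub_cancel _ _).symm,
    exists_isHighTerm_of_mem_spanBelow ((D n).2.1 c)⟩, fun n => ?_, hex₀,
    augmentation_surjective ε⟩
  exact ((D n).2.2.exists_exact hObs).choose_spec.2.1
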